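/- Fix integers $n\ge 0$, $q\ge1$. Let $C\subsetneq\mathbb R^q$, $C\neq\{0\}$, be a closed convex pointed polyhedral cone with non-empty interior, let $X\subseteq\mathbb R^n$ be closed and convex with $\operatorname{int}X\neq\emptyset$, and let $\Gamma:X\to\mathbb R^q$ be continuous and $C$-convex, i.e. $\Gamma(\alpha x+(1-\alpha)y)\le_C\alpha\Gamma(x)+(1-\alpha)\Gamma(y)$ for $x,y\in X$, $\alpha\in[0,1]$, where $u\le_C w$ means $w-u\in C$. Write $\|\cdot\|$ for the $\ell_1$ norm, $B_1(0)$ for its closed unit ball, $\operatorname{cone}A$ for the convex conic hull ($\operatorname{cone}\emptyset=\{0\}$), $A^+=\{z: z^{\mathsf T}a\ge0\ \forall a\in A\}$, $A_\infty=\{d: y+\alpha d\in A\ \forall y\in A,\alpha\ge0\}$, and $\operatorname{vert}A$ for the set of vertices (extreme points) of $A$. An extreme direction of a cone $D$ is a nonzero $y\in D$ that is not a convex combination of elements of $D\setminus\operatorname{cone}\{y\}$. Fix $c\in\operatorname{int}C$ with $\|c\|=1$, a nonsingular $T\in\mathbb R^{q\times q}$ with last column $c$, a finite set $R$ with $\operatorname{cone}R=C$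 and $\|d\|=1$ for $d\in R$, a finite set $R^*$ with $\operatorname{cone}R^*=C^+$ and $c^{\mathsf T}z=1$ for $z\in R^*$, and $\delta>0$. Consider the scalar problems - $P_1(w)$: minimize $w^{\mathsf T}\Gamma(x)$ over $x\in X$; - $P_2(v,d)$, $d\ne0$: maximize $\lambda$ over $x\in X$, $\lambda\in\mathbb R$ with $\Gamma(x)-v-\lambda d\le_C0$; - $D_2(v,d)$: minimize $\sup_{x\in X}\{-w^{\mathsf T}\Gamma(x)\}+w^{\mathsf T}v$ over $w\in C^+$ with $w^{\mathsf T}d=-1$. Algorithm 1. 1. Set $Y_{In}=R$, $\hat C=\emptyset$, $P_0=\mathbb R^q$, $\bar X=\emptyset$, $\bar T=\emptyset$, $b=1$. 2. Choose $x_0\in X$ and set $v=\Gamma(x_0)+\sum_{d\in R}d$. 3. For every $z\in R^*$: if $P_1(z)$ is unbounded, set $b=0$; if $x^*$ is an optimal solution of $P_1(z)$, add $x^*$ to $\bar X$, add $T^{\mathsf T}z$ to $\bar T$, and replace $P_0$ by $P_0\cap\{y: z^{\mathsf T}(y-\Gamma(x^*))\ge0\}$. 4. If $b=1$, set $Y_{Out}=R$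 and stop. 5. For every $d\in-R$: if $P_2(v,d)$ is unbounded, add $d$ to $Y_{In}$; if $(x,\lambda)$ and $w$ are optimal solutions of $P_2(v,d)$ and $D_2(v,d)$, perform the update $U(x,w)$: add $x$ to $\bar X$, add $T^{\mathsf T}\frac{w}{c^{\mathsf T}w}$ to $\bar T$, and replace $P_0$ by $P_0\cap\{y: w^{\mathsf T}(y-\Gamma(x))\ge0\}$. 6. Set $Y_{Out}=\operatorname{vert}((P_0)_\infty\cap B_1(0))\setminus\{0\}$. 7. While $Y_{Out}\setminus(Y_{In}\cup\hat C)\neq\emptyset$, take an element $d$ of it and some $\tilde r\in Y_{In}$ minimizing $\|d-r\|$ over $r\in Y_{In}$. If $\|d-\tilde r\|\le\delta$, add $d$ to $\hat C$. Otherwise choose $\mu\in(0,1)$ with $e=\mu d+(1-\mu)\tilde r\neq0$; if $P_2(v,e)$ is unbounded, add $e/\|e\|$ to $Y_{In}$; if $(x,\lambda)$ and $w$ are optimal solutions of $P_2(v,e)$ and $D_2(v,e)$, perform $U(x,w)$ and recompute $Y_{Out}=\operatorname{vert}((P_0)_\infty\cap B_1(0))\setminus\{0\}$. For $t\in\mathbb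 R^q$ let $w(t)=\big((t_1,\dots,t_{q-1},1)T^{-1}\big)^{\mathsf T}$ and $D^*(t)=\big(t_1,\dots,t_{q-1},\inf_{x\in X}w(t)^{\mathsf T}\Gamma(x)\big)^{\mathsf T}\in\mathbb R^{q-1}\times[-\infty,\infty]$, and let $K=\{(0,\dots,0,k)^{\mathsf T}: k\ge0\}$. The modified geometric dual problem (D') is to maximize $D^*(t)$ with respect to $\le_K$ over $\mathcal T'=\{t: w(t)\in(\operatorname{cone}Y_{Out})^+\}$; $t$ is a maximizer of (D') if $t\in\mathcal T'$ and $D^*(t)$ is $K$-maximal in $D^*(\mathcal T')$, i.e. $(\{D^*(t)\}+K\setminus\{0\})\cap D^*(\mathcal T')=\emptyset$ (with $-\infty+k=-\infty$). Lemma. Suppose that a run of Algorithm 1 (with arbitrary choices of optimal solutions, processing order, $d$, $\tilde r$ and $\mu$) terminates after finitely many steps, and let $\bar T$ and $Y_{Out}$ be the sets it returns. Then: 1. $\bar T\supseteq\{T^{\mathsf T}y : y\text{ is an extreme direction of }(\operatorname{cone}Y_{Out})^+,\ c^{\mathsf T}y=1\}$; 2. every element of $\bar T$ is a maximizer of (D').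 -/

import Mathlib

open scoped Matrix

noncomputable section

namespace UnboundedCVOP

/-! ### Preliminaries on `ℝ^q` -/

/-- The `ℓ₁` norm on `ℝ^q`. -/
def l1Norm {q : ℕ} (x : Fin q → ℝ) : ℝ := ∑ i, |x i|

/-- The closed `ℓ₁` unit ball around the origin. -/
def l1Ball (q : ℕ) : Set (Fin q → ℝ) := {x | l1Norm x ≤ 1}

/-- The convex conic hull of a set, with `cone ∅ = {0}`. -/
def cone {q : ℕ} (A : Set (Fin q → ℝ)) : Set (Fin q → ℝ) :=
  (PointedCone.hull ℝ A : Set (Fin q → ℝ))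

/-- The positive dual cone `A⁺`. -/
def posDual {q : ℕ} (A : Set (Fin q → ℝ)) : Set (Fin q → ℝ) :=
  {z | ∀ a ∈ A, 0 ≤ z ⬝ᵥ a}

/-- The recession cone `A_∞`. -/
def recCone {q : ℕ} (A : Set (Fin q → ℝ)) : Set (Fin q → ℝ) :=
  {d | ∀ y ∈ A, ∀ α : ℝ, 0 ≤ α → y + α • d ∈ A}

/-- `y` is an extreme direction of the cone `C`: a nonzero element of `C` that is not a convex
combination of elements of `C \ cone {y}`. -/
def IsExtremeDirection {q : ℕ} (C : Set (Fin q → ℝ)) (y : Fin q → ℝ) : Prop :=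
  y ∈ C ∧ y ≠ 0 ∧ y ∉ convexHull ℝ (C \ cone {y})

/-- `A` is polyhedral convex: a finite intersection of closed halfspaces. -/
def IsPolyhedral {q : ℕ} (A : Set (Fin q → ℝ)) : Prop :=
  ∃ (r : ℕ) (w : Fin r → Fin q → ℝ) (γ : Fin r → ℝ), (∀ i, w i ≠ 0) ∧
    A = ⋂ i, {y | γ i ≤ w i ⬝ᵥ y}

/-- `C` is a convex cone: `α C ⊆ C` for `α > 0` and `C + C ⊆ C`. -/
def IsConvexCone {q : ℕ} (C : Set (Fin q → ℝ)) : Prop :=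
  (∀ α : ℝ, 0 < α → ∀ y ∈ C, α • y ∈ C) ∧ ∀ y ∈ C, ∀ z ∈ C, y + z ∈ C

/-- A cone is pointed if it contains no line through the origin. -/
def IsPointed {q : ℕ} (C : Set (Fin q → ℝ)) : Prop :=
  ∀ d ∈ C, -d ∈ C → d = 0

/-- A cone is non-trivial if `{0} ⊊ C ⊊ ℝ^q`. -/
def IsNontrivialCone {q : ℕ} (C : Set (Fin q → ℝ)) : Prop :=
  {0} ⊂ C ∧ C ⊂ Set.univ

/-- The relation `v ≤_C w`. -/
def LeCone {q : ℕ} (C : Set (Fin q → ℝ)) (v w : Fin q → ℝ) : Prop := w - v ∈ C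

/-! ### The convex vector optimization problem -/

/-- The data of the problem: minimize `Γ x` with respect to `≤_C` subject to `x ∈ X`.
Only the values of `Γ` on `X` are ever used. -/
structure Problem (n q : ℕ) where
  C : Set (Fin q → ℝ)
  X : Set (Fin n → ℝ)
  Γ : (Fin n → ℝ) → (Fin q → ℝ)

namespace Problem

variable {n q : ℕ} (P : Problem n q)

/-- `Γ` is `C`-convex on `X`. -/
def IsCConvex : Prop :=
  ∀ x ∈ P.X, ∀ y ∈ P.X, ∀ α : ℝ, 0 ≤ α → α ≤ 1 →
    LeCone P.C (P.Γ (α • x + (1 - α) • y)) (α • P.Γ x + (1 - α) • P.Γ y)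

/-- The standing assumptions, including polyhedrality of the ordering cone. -/
structure Assumptions : Prop where
  X_closed : IsClosed P.X
  X_convex : Convex ℝ P.X
  X_solid : (interior P.X).Nonempty
  C_closed : IsClosed P.C
  C_cone : IsConvexCone P.C
  C_nontrivial : IsNontrivialCone P.C
  C_pointed : IsPointed P.C
  C_solid : (interior P.C).Nonempty
  C_polyhedral : IsPolyhedral P.C
  Γ_continuous : ContinuousOn P.Γ P.X
  Γ_convex : P.IsCConvex

/-! ### Scalarizations -/

/-- `x` is an optimal solution of the weighted sum scalarization `P₁(w)`. -/
def IsOptP1 (w : Fin q → ℝ) (x : Fin n → ℝ) : Prop :=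
  x ∈ P.X ∧ ∀ x' ∈ P.X, w ⬝ᵥ P.Γ x ≤ w ⬝ᵥ P.Γ x'

/-- `P₁(w)` is unbounded. -/
def UnboundedP1 (w : Fin q → ℝ) : Prop :=
  ∀ M : ℝ, ∃ x ∈ P.X, w ⬝ᵥ P.Γ x < M

/-- `(x, z)` is feasible for the Pascoletti-Serafini scalarization `P₂(v, d)`. -/
def FeasP2 (v d : Fin q → ℝ) (x : Fin n → ℝ) (z : ℝ) : Prop :=
  x ∈ P.X ∧ LeCone P.C (P.Γ x - v - z • d) 0

/-- `(x, z)` is an optimal solution of `P₂(v, d)` (maximize `z`). -/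
def IsOptP2 (v d : Fin q → ℝ) (x : Fin n → ℝ) (z : ℝ) : Prop :=
  P.FeasP2 v d x z ∧ ∀ x' z', P.FeasP2 v d x' z' → z' ≤ z

/-- `P₂(v, d)` is unbounded. -/
def UnboundedP2 (v d : Fin q → ℝ) : Prop :=
  ∀ M : ℝ, ∃ x z, P.FeasP2 v d x z ∧ M < z

/-- The objective of the Lagrangian dual `D₂(v, d)`, namely `sup_{x ∈ X} {-wᵀ Γ x} + wᵀ v`. -/
def objD2 (v w : Fin q → ℝ) : EReal :=
  (⨆ x ∈ P.X, ((-(w ⬝ᵥ P.Γ x) : ℝ) : EReal)) + ((w ⬝ᵥ v : ℝ) : EReal)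

/-- `w` is feasible for `D₂(v, d)`. -/
def FeasD2 (d w : Fin q → ℝ) : Prop :=
  w ⬝ᵥ d = -1 ∧ w ∈ posDual P.C

/-- `w` is an optimal solution of `D₂(v, d)`. -/
def IsOptD2 (v d w : Fin q → ℝ) : Prop :=
  P.FeasD2 d w ∧ ∀ w', P.FeasD2 d w' → P.objD2 v w ≤ P.objD2 v w'

end Problem

/-! ### The algorithm computing the outer approximation -/

/-- Control states. The for-loops over `R*` and over `-R` carry the set of directions that
have not been treated yet. -/
inductive Phase (q : ℕ) where
  | feasibility
  | infeasible
  | boundedness (todo : Set (Fin q → ℝ))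
  | boundednessCheck
  | lineality (todo : Set (Fin q → ℝ))
  | outer
  | loop
  | finished

/-- The variables of the algorithm. -/
structure AlgState (n q : ℕ) where
  phase : Phase q
  YIn : Set (Fin q → ℝ)
  Chat : Set (Fin q → ℝ)
  P0 : Set (Fin q → ℝ)
  Xbar : Set (Fin n → ℝ)
  b : Bool
  Tbar : Set (Fin q → ℝ)
  v : Fin q → ℝ
  YOut : Set (Fin q → ℝ)

/-- The halfspace `{y | wᵀ (y - p) ≥ 0}`. -/
def halfspace {q : ℕ} (w p : Fin q → ℝ) : Set (Fin q → ℝ) :=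
  {y | 0 ≤ w ⬝ᵥ (y - p)}

/-- The nonzero vertices of `(P₀)_∞ ∩ B₁(0)`. -/
def outerDirections {q : ℕ} (P0 : Set (Fin q → ℝ)) : Set (Fin q → ℝ) :=
  Set.extremePoints ℝ (recCone P0 ∩ l1Ball q) \ {0}

/-- The state after initialization (`v` and `YOut` are only assigned later). -/
def initState (n : ℕ) {q : ℕ} (R : Finset (Fin q → ℝ)) : AlgState n q where
  phase := .feasibility
  YIn := R
  Chat := ∅
  P0 := Set.univ
  Xbar := ∅
  b := true
  Tbar := ∅
  v := 0
  YOut := ∅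

/-- The update performed when `x` and `w` are optimal solutions of `P₂(v, d)` and `D₂(v, d)`. -/
def AlgState.cut {n q : ℕ} (s : AlgState n q) (P : Problem n q) (c : Fin q → ℝ)
    (T : Matrix (Fin q) (Fin q) ℝ) (x : Fin n → ℝ) (w : Fin q → ℝ) : AlgState n q :=
  { s with
    Xbar := s.Xbar ∪ {x}
    Tbar := s.Tbar ∪ {Tᵀ *ᵥ ((c ⬝ᵥ w)⁻¹ • w)}
    P0 := s.P0 ∩ halfspace w (P.Γ x) }

/-- One step of the algorithm for the problem `P`, with normalizing direction `c`, matrix `T`,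
generators `R` of `C` and `Rstar` of `C⁺`, and tolerance `δ`. All choices (optimal solutions,
order of treatment, nearest inner direction, `λ ∈ (0, 1)`) are left free. -/
inductive AlgStep {n q : ℕ} (P : Problem n q) (c : Fin q → ℝ) (T : Matrix (Fin q) (Fin q) ℝ)
    (R Rstar : Finset (Fin q → ℝ)) (δ : ℝ) : AlgState n q → AlgState n q → Prop
  /-- Feasibility check: the problem is infeasible, stop without output. -/
  | infeasible (s : AlgState n q) (hs : s.phase = .feasibility) (hX : P.X = ∅) :
      AlgStep P c T R Rstar δ s { s with phase := .infeasible }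
  /-- Feasibility check: a feasible point is found and `v` is set. -/
  | feasible (s : AlgState n q) (hs : s.phase = .feasibility)
      (x₀ : Fin n → ℝ) (hx₀ : x₀ ∈ P.X) :
      AlgStep P c T R Rstar δ s
        { s with phase := .boundedness Rstar, v := P.Γ x₀ + ∑ d ∈ R, d }
  /-- Boundedness check: `P₁(z)` is unbounded. -/
  | boundednessUnb (s : AlgState n q) (todo : Set (Fin q → ℝ))
      (hs : s.phase = .boundedness todo) (z : Fin q → ℝ) (hz : z ∈ todo)
      (hu : P.UnboundedP1 z) :
      AlgStep P c T R Rstar δ s { s with phase := .boundedness (todo \ {z}), b := false }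
  /-- Boundedness check: `P₁(z)` has the optimal solution `x`. -/
  | boundednessOpt (s : AlgState n q) (todo : Set (Fin q → ℝ))
      (hs : s.phase = .boundedness todo) (z : Fin q → ℝ) (hz : z ∈ todo)
      (x : Fin n → ℝ) (hx : P.IsOptP1 z x) :
      AlgStep P c T R Rstar δ s
        { s with
          phase := .boundedness (todo \ {z})
          Xbar := s.Xbar ∪ {x}
          Tbar := s.Tbar ∪ {Tᵀ *ᵥ z}
          P0 := s.P0 ∩ halfspace z (P.Γ x) }
  /-- End of the for-loop over `R*`. -/
  | boundednessEnd (s : AlgState n q) (hs : s.phase = .boundedness ∅) :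
      AlgStep P c T R Rstar δ s { s with phase := .boundednessCheck }
  /-- The problem is bounded: return `R` as the set of outer directions and stop. -/
  | stopBounded (s : AlgState n q) (hs : s.phase = .boundednessCheck) (hb : s.b = true) :
      AlgStep P c T R Rstar δ s { s with phase := .finished, YOut := R }
  /-- The problem is unbounded: start the for-loop over `-R`. -/
  | continueUnbounded (s : AlgState n q) (hs : s.phase = .boundednessCheck)
      (hb : s.b = false) :
      AlgStep P c T R Rstar δ s { s with phase := .lineality {d | -d ∈ R} }
  /-- Lineality check: `P₂(v, d)` is unbounded. -/
  | linealityUnb (s : AlgState n q) (todo : Set (Fin q → ℝ))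
      (hs : s.phase = .lineality todo) (d : Fin q → ℝ) (hd : d ∈ todo)
      (hu : P.UnboundedP2 s.v d) :
      AlgStep P c T R Rstar δ s
        { s with phase := .lineality (todo \ {d}), YIn := s.YIn ∪ {d} }
  /-- Lineality check: `P₂(v, d)` and `D₂(v, d)` have optimal solutions. -/
  | linealityOpt (s : AlgState n q) (todo : Set (Fin q → ℝ))
      (hs : s.phase = .lineality todo) (d : Fin q → ℝ) (hd : d ∈ todo)
      (x : Fin n → ℝ) (z : ℝ) (hx : P.IsOptP2 s.v d x z)
      (w : Fin q → ℝ) (hw : P.IsOptD2 s.v d w) :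
      AlgStep P c T R Rstar δ s
        { s.cut P c T x w with phase := .lineality (todo \ {d}) }
  /-- End of the for-loop over `-R`. -/
  | linealityEnd (s : AlgState n q) (hs : s.phase = .lineality ∅) :
      AlgStep P c T R Rstar δ s { s with phase := .outer }
  /-- Compute the outer directions and enter the while-loop. -/
  | computeOuter (s : AlgState n q) (hs : s.phase = .outer) :
      AlgStep P c T R Rstar δ s { s with phase := .loop, YOut := outerDirections s.P0 }
  /-- While-loop: the outer direction `d` is within `δ` of its nearest inner direction `r`. -/
  | loopClose (s : AlgState n q) (hs : s.phase = .loop)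
      (d : Fin q → ℝ) (hd : d ∈ s.YOut \ (s.YIn ∪ s.Chat))
      (r : Fin q → ℝ) (hr : r ∈ s.YIn) (hmin : ∀ r' ∈ s.YIn, l1Norm (d - r) ≤ l1Norm (d - r'))
      (hδ : l1Norm (d - r) ≤ δ) :
      AlgStep P c T R Rstar δ s { s with Chat := s.Chat ∪ {d} }
  /-- While-loop: `d` is further than `δ` from `r` and `P₂(v, e)` is unbounded for the combination
  `e = λ d + (1 - λ) r`. The scalarization is only defined for a nonzero direction `e`. -/
  | loopUnb (s : AlgState n q) (hs : s.phase = .loop)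
      (d : Fin q → ℝ) (hd : d ∈ s.YOut \ (s.YIn ∪ s.Chat))
      (r : Fin q → ℝ) (hr : r ∈ s.YIn) (hmin : ∀ r' ∈ s.YIn, l1Norm (d - r) ≤ l1Norm (d - r'))
      (hδ : δ < l1Norm (d - r))
      (lam : ℝ) (hlam0 : 0 < lam) (hlam1 : lam < 1)
      (e : Fin q → ℝ) (he : e = lam • d + (1 - lam) • r) (he0 : e ≠ 0)
      (hu : P.UnboundedP2 s.v e) :
      AlgStep P c T R Rstar δ s { s with YIn := s.YIn ∪ {(l1Norm e)⁻¹ • e} }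
  /-- While-loop: `d` is further than `δ` from `r` and `P₂(v, e)`, `D₂(v, e)` have optimal
  solutions. -/
  | loopOpt (s : AlgState n q) (hs : s.phase = .loop)
      (d : Fin q → ℝ) (hd : d ∈ s.YOut \ (s.YIn ∪ s.Chat))
      (r : Fin q → ℝ) (hr : r ∈ s.YIn) (hmin : ∀ r' ∈ s.YIn, l1Norm (d - r) ≤ l1Norm (d - r'))
      (hδ : δ < l1Norm (d - r))
      (lam : ℝ) (hlam0 : 0 < lam) (hlam1 : lam < 1)
      (e : Fin q → ℝ) (he : e = lam • d + (1 - lam) • r) (he0 : e ≠ 0)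
      (x : Fin n → ℝ) (z : ℝ) (hx : P.IsOptP2 s.v e x z)
      (w : Fin q → ℝ) (hw : P.IsOptD2 s.v e w) :
      AlgStep P c T R Rstar δ s
        { s.cut P c T x w with YOut := outerDirections (s.cut P c T x w).P0 }
  /-- End of the while-loop: return. -/
  | loopEnd (s : AlgState n q) (hs : s.phase = .loop)
      (hempty : s.YOut \ (s.YIn ∪ s.Chat) = ∅) :
      AlgStep P c T R Rstar δ s { s with phase := .finished }

/-- Some run of the algorithm terminates after finitely many steps and returns the variables
stored in `s`. -/
def AlgReturns {n q : ℕ} (P : Problem n q) (c : Fin q → ℝ) (T : Matrix (Fin q) (Fin q) ℝ)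
    (R Rstar : Finset (Fin q → ℝ)) (δ : ℝ) (s : AlgState n q) : Prop :=
  Relation.ReflTransGen (AlgStep P c T R Rstar δ) (initState n R) s ∧ s.phase = .finished

/-! ### The modified geometric dual problem, with `q = m + 1` -/

/-- `w(t) = ((t₁, …, t_{q-1}, 1) T⁻¹)ᵀ`. -/
def dualWeight {m : ℕ} (T : Matrix (Fin (m + 1)) (Fin (m + 1)) ℝ) (t : Fin (m + 1) → ℝ) :
    Fin (m + 1) → ℝ :=
  Function.update t (Fin.last m) 1 ᵥ* T⁻¹

/-- The dual objective `D*(t) = (t₁, …, t_{q-1}, inf_{x ∈ X} w(t)ᵀ Γ x)`, with values in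
`ℝ^{q-1} × [-∞, ∞]`. -/
def dualObj {n m : ℕ} (P : Problem n (m + 1)) (T : Matrix (Fin (m + 1)) (Fin (m + 1)) ℝ)
    (t : Fin (m + 1) → ℝ) : (Fin m → ℝ) × EReal :=
  (fun i => t i.castSucc, ⨅ x ∈ P.X, ((dualWeight T t ⬝ᵥ P.Γ x : ℝ) : EReal))

/-- The ordering cone `K = {(0, …, 0, k) | k ≥ 0}` of the dual problem. -/
def coneK (m : ℕ) : Set (Fin (m + 1) → ℝ) :=
  {k | (∀ i : Fin m, k i.castSucc = 0) ∧ 0 ≤ k (Fin.last m)}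

/-- The inclusion of `ℝ^q` in `ℝ^{q-1} × [-∞, ∞]`. -/
def extendReal {m : ℕ} (y : Fin (m + 1) → ℝ) : (Fin m → ℝ) × EReal :=
  (fun i => y i.castSucc, (y (Fin.last m) : EReal))

/-- `y` is a `K`-maximal element of `A`: `y ∈ A` and `({y} + K \ {0}) ∩ A = ∅`. As
`-∞ + k = -∞`, the last component of a maximal element is never `-∞`. -/
def IsKMaximal {m : ℕ} (A : Set ((Fin m → ℝ) × EReal)) (y : (Fin m → ℝ) × EReal) : Prop :=
  y ∈ A ∧ ∀ k ∈ coneK m \ {0}, y + extendReal k ∉ A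

/-- The feasible set `{t | w(t) ∈ (cone Y)⁺}` of the modified geometric dual problem. -/
def dualFeasible {m : ℕ} (T : Matrix (Fin (m + 1)) (Fin (m + 1)) ℝ)
    (Y : Set (Fin (m + 1) → ℝ)) : Set (Fin (m + 1) → ℝ) :=
  {t | dualWeight T t ∈ posDual (cone Y)}

/-- `t` is a maximizer of the modified geometric dual problem: maximize `D*(t)` with respect to
`≤_K` subject to `w(t) ∈ (cone Y)⁺`. -/
def IsDualMaximizer {n m : ℕ} (P : Problem n (m + 1))
    (T : Matrix (Fin (m + 1)) (Fin (m + 1)) ℝ) (Y : Set (Fin (m + 1) → ℝ))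
    (t : Fin (m + 1) → ℝ) : Prop :=
  t ∈ dualFeasible T Y ∧ IsKMaximal (dualObj P T '' dualFeasible T Y) (dualObj P T t)

end UnboundedCVOP

end

namespace UnboundedCVOP

/-! Let `W` be the finite set of normals of all cuts made during a run, rescaled so that `cᵀw = 1`;
then `Tbar` is the image of `W` under `Tᵀ`. Every `w ∈ W` lies in `C⁺` and has `P₁(w)` bounded below
(`AlgStep.invariant`). For cuts from `P₁` this is optimality. For cuts from `P₂` and `D₂`,
separation at a point beyond the optimal value of `P₂` produces some dual feasible weight with
finite objective (`exists_feasD2`), so an optimal dual weight has finite objective too. Strong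
duality is not needed.

Claim 1: the cuts all have normals positive on `c`, so `P0` is nonempty and its recession cone is
`W⁺` (`recCone_biInter_halfspace`). By Krein–Milman the nonzero vertices of `W⁺ ∩ B₁(0)` have the
same dual as `W⁺` (`posDual_extremePoints`), hence `(cone YOut)⁺ = W⁺⁺`. By separation, its slice
`cᵀy = 1` lies in the convex hull of `W` (`mem_convexHull_of_mem_posDual`), and a normalized extreme
direction in that hull must belong to `W`. In the bounded case `YOut = R`, and `R* ⊆ W ⊆ C⁺` leads
to the same conclusion.

Claim 2: `w(Tᵀw) = w` for normalized `w`, so elements of `Tbar` are feasible with finite dual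
objective. Moving along `K` fixes the first `q - 1` components, which determine the weight and hence
the last component, so such points are maximal. -/

variable {n q : ℕ}

/-! ### Dual cones, normalized slices, and recession cones of polyhedra. -/

lemma clm_eq_dotProduct (f : (Fin q → ℝ) →L[ℝ] ℝ) :
    ∃ w : Fin q → ℝ, ∀ y, f y = w ⬝ᵥ y := by
  refine ⟨fun i => f (Pi.single i 1), fun y => ?_⟩
  have h := LinearMap.pi_apply_eq_sum_univ (f : (Fin q → ℝ) →ₗ[ℝ] ℝ) y
  simp only [ContinuousLinearMap.coe_coe] at h
  rw [h, dotProduct]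
  refine Finset.sum_congr rfl fun i _ => ?_
  rw [smul_eq_mul, mul_comm]
  congr 2
  ext j
  simp [Pi.single_apply, eq_comm]

lemma continuous_dotProduct_right (w : Fin q → ℝ) : Continuous fun y : Fin q → ℝ => w ⬝ᵥ y := by
  unfold dotProduct
  fun_prop

lemma isLinearMap_dotProduct_right (w : Fin q → ℝ) :
    IsLinearMap ℝ fun y : Fin q → ℝ => w ⬝ᵥ y :=
  ⟨fun x y => dotProduct_add w x y, fun a x => by simp [dotProduct_smul]⟩

lemma dotProduct_nonneg_of_mem_cone {A : Set (Fin q → ℝ)} {z y : Fin q → ℝ}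
    (hz : ∀ a ∈ A, 0 ≤ z ⬝ᵥ a) (hy : y ∈ cone A) : 0 ≤ z ⬝ᵥ y := by
  change y ∈ Submodule.span _ A at hy
  induction hy using Submodule.span_induction with
  | mem x hx => exact hz x hx
  | zero => simp
  | add x y _ _ hx hy => rw [dotProduct_add]; exact add_nonneg hx hy
  | smul a x _ hx =>
    change 0 ≤ z ⬝ᵥ ((a : ℝ) • x)
    rw [dotProduct_smul, smul_eq_mul]
    exact mul_nonneg a.2 hx

lemma subset_cone (A : Set (Fin q → ℝ)) : A ⊆ cone A :=
  Submodule.subset_span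

lemma posDual_cone (A : Set (Fin q → ℝ)) : posDual (cone A) = posDual A :=
  Set.Subset.antisymm (fun _ hz a ha => hz a (subset_cone A ha))
    fun _ hz _ ha => dotProduct_nonneg_of_mem_cone hz ha

lemma mem_cone_singleton {x y : Fin q → ℝ} (h : x ∈ cone {y}) : ∃ a : ℝ, x = a • y := by
  obtain ⟨a, ha⟩ := Submodule.mem_span_singleton.1 (h : x ∈ Submodule.span _ {y})
  exact ⟨a, ha.symm⟩

/-- A nonzero functional of the dual cone is positive on the interior of the cone. -/
lemma dotProduct_pos_of_mem_interior {C : Set (Fin q → ℝ)} {c w : Fin q → ℝ}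
    (hc : c ∈ interior C) (hw : w ∈ posDual C) (hw0 : w ≠ 0) : 0 < w ⬝ᵥ c := by
  -- Step from `c` against `w`: for small `t > 0` the point `c - t • w` is still in `C`, so `wᵀc ≥ t
  -- wᵀw > 0`.
  have hcont : Continuous fun t : ℝ => c - t • w := by fun_prop
  have hev : ∀ᶠ t in nhds (0 : ℝ), c - t • w ∈ interior C :=
    hcont.continuousAt.eventually (isOpen_interior.mem_nhds (by simpa using hc))
  obtain ⟨t, ht, ht0⟩ := ((hev.filter_mono nhdsWithin_le_nhds).and
    (self_mem_nhdsWithin (a := (0 : ℝ)) (s := Set.Ioi 0))).exists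
  have h := hw _ (interior_subset ht)
  rw [dotProduct_sub, dotProduct_smul, smul_eq_mul] at h
  have hww : 0 < w ⬝ᵥ w := lt_of_le_of_ne
    (Finset.sum_nonneg fun i _ => mul_self_nonneg _) fun h => hw0 (dotProduct_self_eq_zero.1 h.symm)
  have := mul_pos (show 0 < t from ht0) hww
  linarith

/-- The part of the dual of `{d | ∀ w ∈ W, 0 ≤ wᵀ d}` normalized by `c` is the convex hull of the
finite set `W`, if `W` is normalized by `c`. -/
lemma mem_convexHull_of_mem_posDual {W : Set (Fin q → ℝ)} (hW : W.Finite) {c y : Fin q → ℝ}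
    (hWc : ∀ w ∈ W, c ⬝ᵥ w = 1) (hyc : c ⬝ᵥ y = 1)
    (hy : y ∈ posDual {d | ∀ w ∈ W, 0 ≤ w ⬝ᵥ d}) : y ∈ convexHull ℝ W := by
  by_contra hn
  obtain ⟨f, u, h1, h2⟩ := geometric_hahn_banach_point_closed (convex_convexHull ℝ W)
    (hW.isClosed_convexHull ℝ) hn
  obtain ⟨v, hv⟩ := clm_eq_dotProduct f
  rw [hv] at h1
  -- On vectors normalized by `c`, the affine separation at level `u` becomes the linear functional
  -- `v - u • c`: positive on `W`, negative at `y`.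
  have h3 := hy (v - u • c) fun w hw => by
    have := h2 w (subset_convexHull ℝ W hw)
    rw [hv] at this
    rw [dotProduct_sub, dotProduct_smul, dotProduct_comm w c, hWc w hw, dotProduct_comm w v,
      smul_eq_mul]
    linarith
  rw [dotProduct_sub, dotProduct_smul, dotProduct_comm y c, hyc, dotProduct_comm y v,
    smul_eq_mul] at h3
  linarith

/-- The normalization leaves `y` as the only possible element of `W` on its own ray. If `y` were
missing from `W`, all of `W` would avoid `cone {y}`, contradicting extremality. -/
lemma IsExtremeDirection.mem_of_mem_convexHull {D W : Set (Fin q → ℝ)} {c y : Fin q → ℝ}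
    (hy : IsExtremeDirection D y) (hWD : W ⊆ D) (hWc : ∀ w ∈ W, c ⬝ᵥ w = 1)
    (hyc : c ⬝ᵥ y = 1) (h : y ∈ convexHull ℝ W) : y ∈ W := by
  by_contra hyW
  have hsub : W ⊆ D \ cone {y} := by
    refine fun w hw => Set.mem_sdiff_of_mem (hWD hw) fun hwy => hyW ?_
    obtain ⟨a, rfl⟩ := mem_cone_singleton hwy
    have := hWc _ hw
    rw [dotProduct_smul, hyc, smul_eq_mul, mul_one] at this
    simpa [this] using hw
  exact hy.2.2 (convexHull_mono hsub h)

lemma convex_l1Ball (q : ℕ) : Convex ℝ (l1Ball q) := by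
  intro x hx y hy a b ha hb hab
  simp only [l1Ball, l1Norm, Set.mem_ofPred_eq] at *
  calc ∑ i, |(a • x + b • y) i| ≤ ∑ i, (a * |x i| + b * |y i|) := by
        refine Finset.sum_le_sum fun i _ => ?_
        refine (abs_add_le _ _).trans ?_
        simp [abs_mul, abs_of_nonneg ha, abs_of_nonneg hb]
    _ = a * ∑ i, |x i| + b * ∑ i, |y i| := by
        rw [Finset.sum_add_distrib, Finset.mul_sum, Finset.mul_sum]
    _ ≤ a * 1 + b * 1 := by gcongr
    _ = 1 := by linarith

lemma isCompact_l1Ball (q : ℕ) : IsCompact (l1Ball q) := by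
  refine Metric.isCompact_of_isClosed_isBounded ?_ ?_
  · exact isClosed_le (by unfold l1Norm; fun_prop) continuous_const
  · refine (Metric.isBounded_closedBall (x := (0 : Fin q → ℝ)) (r := 1)).subset fun x hx => ?_
    rw [mem_closedBall_zero_iff, pi_norm_le_iff_of_nonneg zero_le_one]
    exact fun i => (Finset.single_le_sum (f := fun i => |x i|) (fun i _ => abs_nonneg _)
      (Finset.mem_univ i)).trans hx

/-- The dual cone of a closed convex cone is determined by the nonzero vertices of its
intersection with the unit ball. -/
lemma posDual_extremePoints {D : Set (Fin q → ℝ)} (hD : IsClosed D) (hDconv : Convex ℝ D)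
    (hDsmul : ∀ a : ℝ, 0 < a → ∀ d ∈ D, a • d ∈ D) :
    posDual (Set.extremePoints ℝ (D ∩ l1Ball q) \ {0}) = posDual D := by
  refine Set.Subset.antisymm (fun z hz d hd => ?_) fun z hz d hd => hz d hd.1.1.1
  -- Krein–Milman: nonnegativity at the vertices passes to the whole compact section. Dropping the
  -- vertex `0` is harmless, since every functional vanishes there.
  have hKM := closure_convexHull_extremePoints
    ((isCompact_l1Ball q).inter_left hD) (hDconv.inter (convex_l1Ball q))
  have hsub : D ∩ l1Ball q ⊆ {y | 0 ≤ z ⬝ᵥ y} := by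
    rw [← hKM]
    refine closure_minimal (convexHull_min (fun y hy => ?_)
      (convex_halfSpace_ge (isLinearMap_dotProduct_right z) 0))
      (isClosed_le continuous_const (continuous_dotProduct_right z))
    by_cases h0 : y = 0
    · simp [h0]
    · exact hz y ⟨hy, h0⟩
  -- Scaling by `1 + ‖d‖` instead of `‖d‖` brings `d` into the ball without a separate case `d = 0`.
  have hpos : 0 < 1 + l1Norm d :=
    add_pos_of_pos_of_nonneg one_pos (Finset.sum_nonneg fun i _ => abs_nonneg _)
  have h := hsub (a := (1 + l1Norm d)⁻¹ • d) ⟨hDsmul _ (inv_pos.2 hpos) d hd, by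
    simp only [l1Ball, l1Norm, Set.mem_ofPred_eq, Pi.smul_apply, smul_eq_mul, abs_mul,
      ← Finset.mul_sum]
    change |(1 + l1Norm d)⁻¹| * l1Norm d ≤ 1
    rw [abs_of_pos (inv_pos.2 hpos), inv_mul_le_iff₀ hpos]
    linarith⟩
  rw [Set.mem_ofPred_eq, dotProduct_smul, smul_eq_mul] at h
  exact (mul_nonneg_iff_of_pos_left (inv_pos.2 hpos)).1 h

/-- The recession cone of a finite intersection of halfspaces whose normals are positive on a
common vector `c`. -/
lemma recCone_biInter_halfspace {F : Set ((Fin q → ℝ) × (Fin q → ℝ))} (hF : F.Finite)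
    {c : Fin q → ℝ} (hc : ∀ p ∈ F, c ⬝ᵥ p.1 = 1) :
    recCone (⋂ p ∈ F, halfspace p.1 p.2) = {d | ∀ w ∈ Prod.fst '' F, 0 ≤ w ⬝ᵥ d} := by
  ext d
  simp only [recCone, Set.mem_ofPred_eq, Set.mem_iInter, halfspace, Set.forall_mem_image]
  constructor
  · intro h p hp
    obtain ⟨N, hN⟩ : ∃ N : ℝ, ∀ p ∈ F, p.1 ⬝ᵥ p.2 ≤ N := by
      obtain ⟨N, hN⟩ := (hF.image fun p => p.1 ⬝ᵥ p.2).bddAbove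
      exact ⟨N, fun p hp => hN ⟨p, hp, rfl⟩⟩
    by_contra! hneg
    -- `N • c` lies in every halfspace. This base point is essential: the recession cone of an empty
    -- set would be the whole space.
    have key : ∀ α : ℝ, 0 ≤ α → 0 ≤ N + α * (p.1 ⬝ᵥ d) - p.1 ⬝ᵥ p.2 := fun α hα => by
      have := h (N • c) (fun p hp => by
        rw [dotProduct_sub, dotProduct_smul, dotProduct_comm, hc p hp, smul_eq_mul]
        linarith [hN p hp]) α hα p hp
      rwa [dotProduct_sub, dotProduct_add, dotProduct_smul, dotProduct_smul,
        dotProduct_comm _ c, hc p hp, smul_eq_mul, smul_eq_mul, mul_one] at this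
    -- This step length makes the right-hand side of `key` equal to `-1`.
    have h1 := key ((N - p.1 ⬝ᵥ p.2 + 1) / -(p.1 ⬝ᵥ d))
      (div_nonneg (by linarith [hN p hp]) (by linarith))
    rw [div_mul_eq_mul_div, div_neg, mul_div_assoc, div_self hneg.ne] at h1
    linarith
  · intro h y hy α hα p hp
    rw [add_sub_right_comm, dotProduct_add, dotProduct_smul, smul_eq_mul]
    exact add_nonneg (hy p hp) (mul_nonneg hα (h hp))

/-! ### The extended image and finiteness of the scalar dual values. -/

namespace Problem

variable {P : Problem n q} {c : Fin q → ℝ} {R : Finset (Fin q → ℝ)}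

lemma Assumptions.add_mem (hP : P.Assumptions) {y z : Fin q → ℝ} (hy : y ∈ P.C) (hz : z ∈ P.C) :
    y + z ∈ P.C := hP.C_cone.2 y hy z hz

lemma Assumptions.zero_mem (hP : P.Assumptions) : (0 : Fin q → ℝ) ∈ P.C :=
  hP.C_nontrivial.1.1 rfl

lemma Assumptions.smul_mem (hP : P.Assumptions) {a : ℝ} (ha : 0 ≤ a) {y : Fin q → ℝ}
    (hy : y ∈ P.C) : a • y ∈ P.C := by
  rcases ha.eq_or_lt with rfl | h
  · simpa using hP.zero_mem
  · exact hP.C_cone.1 a h y hy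

/-- The extended image `Γ(X) + C`. -/
def extImage (P : Problem n q) : Set (Fin q → ℝ) := {y | ∃ x ∈ P.X, y - P.Γ x ∈ P.C}

lemma Assumptions.convex_extImage (hP : P.Assumptions) : Convex ℝ P.extImage := by
  rintro y ⟨x, hx, hy⟩ y' ⟨x', hx', hy'⟩ a b ha hb hab
  obtain rfl : b = 1 - a := by linarith
  refine ⟨a • x + (1 - a) • x', hP.X_convex hx hx' ha hb hab, ?_⟩
  have h := hP.Γ_convex x hx x' hx' a ha (by linarith)
  have := hP.add_mem h (hP.add_mem (hP.smul_mem ha hy) (hP.smul_mem hb hy'))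
  convert this using 1
  module

/-- The interior point `c` of the cone leaves room around `Γ x + ε • c + k`. These are the test
points for a separating functional: large `k` shows that it lies in `C⁺`, suitable `ε` bounds it on
`Γ(X)`. -/
lemma Assumptions.mem_interior_extImage (hP : P.Assumptions) (hc : c ∈ interior P.C)
    {x : Fin n → ℝ} (hx : x ∈ P.X) {k : Fin q → ℝ} (hk : k ∈ P.C) {ε : ℝ} (hε : 0 < ε) :
    P.Γ x + ε • c + k ∈ interior P.extImage := by
  have hcont : Continuous fun y : Fin q → ℝ => ε⁻¹ • (y - P.Γ x - k) := by fun_prop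
  have hsub : (fun y => ε⁻¹ • (y - P.Γ x - k)) ⁻¹' interior P.C ⊆ P.extImage := by
    refine fun y hy => ⟨x, hx, ?_⟩
    have := hP.add_mem (hP.smul_mem hε.le (interior_subset hy)) hk
    rwa [smul_inv_smul₀ hε.ne', sub_add_cancel] at this
  refine interior_maximal hsub (isOpen_interior.preimage hcont) ?_
  have : ε⁻¹ • (P.Γ x + ε • c + k - P.Γ x - k) = c := by
      rw [show P.Γ x + ε • c + k - P.Γ x - k = ε • c by abel, inv_smul_smul₀ hε.ne']
  rwa [Set.mem_preimage, this]

lemma sum_mem_of_cone_eq (hR : cone (R : Set (Fin q → ℝ)) = P.C) :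
    ∑ d ∈ R, d ∈ P.C := by
  rw [← hR]
  exact Submodule.sum_mem _ fun d hd => subset_cone _ hd

/-- If `P₂(v, d)` has an optimal solution, then `D₂(v, d)` has a feasible point with finite
objective, since `v` satisfies Slater's condition. -/
lemma Assumptions.exists_feasD2 (hP : P.Assumptions) (hc : c ∈ interior P.C)
    (hR : cone (R : Set (Fin q → ℝ)) = P.C) {x₀ : Fin n → ℝ} (hx₀ : x₀ ∈ P.X)
    {d : Fin q → ℝ} {x : Fin n → ℝ} {z : ℝ}
    (hx : P.IsOptP2 (P.Γ x₀ + ∑ r ∈ R, r) d x z) :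
    ∃ w, P.FeasD2 d w ∧ ∃ β : ℝ, ∀ x ∈ P.X, β ≤ w ⬝ᵥ P.Γ x := by
  set v := P.Γ x₀ + ∑ r ∈ R, r with hv
  have hz : 0 ≤ z := hx.2 x₀ 0 ⟨hx₀, by simpa [LeCone, hv] using sum_mem_of_cone_eq hR⟩
  -- A point of the extended image on the ray from `v` along `d` gives a feasible value of `P₂`, and
  -- `z + 1` exceeds the optimum.
  have hnot : v + (z + 1) • d ∉ interior P.extImage := fun h => by
    obtain ⟨x', hx', h'⟩ := interior_subset h
    have := hx.2 x' (z + 1) ⟨hx', by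
      have e : 0 - (P.Γ x' - v - (z + 1) • d) = v + (z + 1) • d - P.Γ x' := by abel
      rwa [LeCone, e]⟩
    linarith
  obtain ⟨f, hf⟩ := geometric_hahn_banach_open_point hP.convex_extImage.interior
    isOpen_interior hnot
  obtain ⟨g, hg⟩ := clm_eq_dotProduct (-f)
  have hlt : ∀ y ∈ interior P.extImage, g ⬝ᵥ (v + (z + 1) • d) < g ⬝ᵥ y := fun y hy => by
    rw [← hg, ← hg]
    simpa only [neg_apply, neg_lt_neg_iff] using hf y hy
  set p := g ⬝ᵥ (v + (z + 1) • d) with hp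
  have hgC : g ∈ posDual P.C := fun k hk => by
    by_contra! hneg
    have h1 := hlt _ (hP.mem_interior_extImage hc hx₀ hP.zero_mem one_pos)
    rw [add_zero, one_smul] at h1
    set A := g ⬝ᵥ (P.Γ x₀ + c)
    -- The multiple of `k` is chosen so that `g` takes exactly the value `p`, against the strict
    -- inequality `hlt`.
    have h2 := hlt _ (hP.mem_interior_extImage hc hx₀
      (hP.smul_mem (a := (A - p) / -(g ⬝ᵥ k)) (div_nonneg (by linarith) (by linarith)) hk) one_pos)
    rw [one_smul, dotProduct_add, dotProduct_smul, smul_eq_mul, div_mul_eq_mul_div, div_neg,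
      mul_div_assoc, div_self hneg.ne] at h2
    linarith
  have hg0 : g ≠ 0 := by
    rintro rfl
    have h1 := hlt _ (hP.mem_interior_extImage hc hx₀ hP.zero_mem one_pos)
    simp [hp] at h1
  have hgc := dotProduct_pos_of_mem_interior hc hgC hg0
  have hge : ∀ x ∈ P.X, p ≤ g ⬝ᵥ P.Γ x := fun x hx => by
    by_contra! hneg
    -- Again `ε = (p - gᵀΓ x) / gᵀc` lands exactly on the value `p`.
    have h1 := hlt _ (hP.mem_interior_extImage hc hx hP.zero_mem
      (div_pos (sub_pos.2 hneg) hgc))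
    rw [add_zero, dotProduct_add, dotProduct_smul, smul_eq_mul, div_mul_cancel₀ _ hgc.ne'] at h1
    linarith
  -- If `g` vanished on the sum it would vanish on each generator, hence on `C`, contradicting `gᵀc
  -- > 0`.
  have hsum : 0 < g ⬝ᵥ ∑ r ∈ R, r := by
    refine (hgC _ (sum_mem_of_cone_eq hR)).lt_of_ne fun h0 => ?_
    rw [dotProduct_sum] at h0
    have hnn : ∀ r ∈ R, 0 ≤ g ⬝ᵥ r := fun r hr => hgC r (hR ▸ subset_cone _ hr)
    have hzero := (Finset.sum_eq_zero_iff_of_nonneg hnn).1 h0.symm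
    have hcC : c ∈ cone (R : Set (Fin q → ℝ)) := hR ▸ interior_subset hc
    have := dotProduct_nonneg_of_mem_cone (z := -g)
      (fun r hr => by simp [hzero r hr]) hcC
    rw [neg_dotProduct] at this
    linarith
  -- The Slater condition enters here: `gᵀv > gᵀΓ x₀ ≥ p = gᵀv + (z + 1) gᵀd`. This permits
  -- rescaling `g` to satisfy `wᵀd = -1`.
  have hgd : g ⬝ᵥ d < 0 := by
    have h1 := hge x₀ hx₀
    rw [hp, dotProduct_add, dotProduct_smul, hv, dotProduct_add, smul_eq_mul] at h1
    by_contra! h2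
    have := mul_nonneg (by linarith : 0 ≤ z + 1) h2
    linarith
  have hinv : 0 ≤ (-(g ⬝ᵥ d))⁻¹ := inv_nonneg.2 (by linarith)
  refine ⟨(-(g ⬝ᵥ d))⁻¹ • g, ⟨?_, fun k hk => ?_⟩, (-(g ⬝ᵥ d))⁻¹ * p, fun x hx => ?_⟩
  · rw [smul_dotProduct, smul_eq_mul, inv_neg, neg_mul, inv_mul_cancel₀ hgd.ne]
  · rw [smul_dotProduct]
    exact mul_nonneg hinv (hgC k hk)
  · rw [smul_dotProduct]
    exact mul_le_mul_of_nonneg_left (hge x hx) hinv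

lemma objD2_lt_top_iff {v w : Fin q → ℝ} :
    P.objD2 v w < ⊤ ↔ ∃ β : ℝ, ∀ x ∈ P.X, β ≤ w ⬝ᵥ P.Γ x := by
  constructor
  · intro h
    have hS : (⨆ x ∈ P.X, ((-(w ⬝ᵥ P.Γ x) : ℝ) : EReal)) ≠ ⊤ := fun hS => by
      rw [objD2, hS, EReal.top_add_coe] at h
      exact lt_irrefl _ h
    -- The supremum is `⊥` only for empty `X`; `toReal` then defaults to `0` and the bound is
    -- vacuous.
    refine ⟨-(⨆ x ∈ P.X, ((-(w ⬝ᵥ P.Γ x) : ℝ) : EReal)).toReal, fun x hx => ?_⟩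
    have h1 := (le_iSup₂ (f := fun x (_ : x ∈ P.X) => ((-(w ⬝ᵥ P.Γ x) : ℝ) : EReal)) x hx).trans
      (EReal.le_coe_toReal hS)
    have := EReal.coe_le_coe_iff.1 h1
    linarith
  · rintro ⟨β, hβ⟩
    have h1 : (⨆ x ∈ P.X, ((-(w ⬝ᵥ P.Γ x) : ℝ) : EReal)) ≤ ((-β : ℝ) : EReal) :=
      iSup₂_le fun x hx => EReal.coe_le_coe_iff.2 (neg_le_neg (hβ x hx))
    refine (add_le_add_left h1 _).trans_lt ?_
    rw [← EReal.coe_add]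
    exact EReal.coe_lt_top _

/-- An optimal solution of `D₂(v, d)` is a weight for which the weighted sum is bounded below. -/
lemma Assumptions.bddBelow_of_isOptD2 (hP : P.Assumptions) (hc : c ∈ interior P.C)
    (hR : cone (R : Set (Fin q → ℝ)) = P.C) {x₀ : Fin n → ℝ} (hx₀ : x₀ ∈ P.X)
    {d w : Fin q → ℝ} {x : Fin n → ℝ} {z : ℝ}
    (hx : P.IsOptP2 (P.Γ x₀ + ∑ r ∈ R, r) d x z) (hw : P.IsOptD2 (P.Γ x₀ + ∑ r ∈ R, r) d w) :
    ∃ β : ℝ, ∀ x ∈ P.X, β ≤ w ⬝ᵥ P.Γ x := by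
  obtain ⟨w', hw', h⟩ := hP.exists_feasD2 hc hR hx₀ hx
  exact objD2_lt_top_iff.1 ((hw.2 w' hw').trans_lt (objD2_lt_top_iff.2 h))

end Problem

/-! ### Invariants of the algorithm -/

/-- `w` is an element of `C⁺` normalized by `c` for which `P₁(w)` is bounded. -/
structure IsBoundedWeight (P : Problem n q) (c w : Fin q → ℝ) : Prop where
  normalized : c ⬝ᵥ w = 1
  mem_posDual : w ∈ posDual P.C
  bddBelow : ∃ β : ℝ, ∀ x ∈ P.X, β ≤ w ⬝ᵥ P.Γ x

/-- The pairs in `F` are the normals and points of the cuts recorded in the state `s`. -/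
structure IsCutSet (P : Problem n q) (c : Fin q → ℝ) (T : Matrix (Fin q) (Fin q) ℝ)
    (F : Set ((Fin q → ℝ) × (Fin q → ℝ))) (s : AlgState n q) : Prop where
  finite : F.Finite
  P0_eq : s.P0 = ⋂ p ∈ F, halfspace p.1 p.2
  Tbar_eq : s.Tbar = (fun p => Tᵀ *ᵥ p.1) '' F
  weight : ∀ p ∈ F, IsBoundedWeight P c p.1

/-- The point `v` of the state has been set. -/
def HasSlaterPoint (P : Problem n q) (R : Finset (Fin q → ℝ)) (s : AlgState n q) : Prop :=
  ∃ x₀ ∈ P.X, s.v = P.Γ x₀ + ∑ d ∈ R, d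

/-- The part of the invariant that depends on the phase. -/
def PhaseInvariant (P : Problem n q) (R Rstar : Finset (Fin q → ℝ))
    (F : Set ((Fin q → ℝ) × (Fin q → ℝ))) (s : AlgState n q) : Prop :=
  match s.phase with
  | .feasibility => True
  | .infeasible => True
  | .boundedness todo => HasSlaterPoint P R s ∧
      (s.b = true → ∀ z ∈ Rstar, z ∈ todo ∨ z ∈ Prod.fst '' F) ∧ todo ⊆ Rstar
  | .boundednessCheck => HasSlaterPoint P R s ∧ (s.b = true → ∀ z ∈ Rstar, z ∈ Prod.fst '' F)
  | .lineality _ => HasSlaterPoint P R s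
  | .outer => HasSlaterPoint P R s
  | .loop => HasSlaterPoint P R s ∧ s.YOut = outerDirections s.P0
  -- The alternatives are the two exits: the while-loop, and the early stop for bounded problems,
  -- where `YOut` is not computed from `P0`.
  | .finished => s.YOut = outerDirections s.P0 ∨
      (s.YOut = R ∧ ∀ z ∈ Rstar, z ∈ Prod.fst '' F)

lemma halfspace_smul {a : ℝ} (ha : 0 < a) (w p : Fin q → ℝ) :
    halfspace (a • w) p = halfspace w p := by
  ext y
  simp only [halfspace, Set.mem_ofPred_eq, smul_dotProduct, smul_eq_mul]
  exact mul_nonneg_iff_of_pos_left ha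

section Invariant

variable {P : Problem n q} {c : Fin q → ℝ} {T : Matrix (Fin q) (Fin q) ℝ}
  {R Rstar : Finset (Fin q → ℝ)} {F : Set ((Fin q → ℝ) × (Fin q → ℝ))} {s s' : AlgState n q}

lemma IsCutSet.congr (h : IsCutSet P c T F s) (h0 : s'.P0 = s.P0) (hT : s'.Tbar = s.Tbar) :
    IsCutSet P c T F s' :=
  ⟨h.finite, h0.trans h.P0_eq, hT.trans h.Tbar_eq, h.weight⟩

lemma IsCutSet.insert (h : IsCutSet P c T F s) {w p : Fin q → ℝ} (hw : IsBoundedWeight P c w)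
    (h0 : s'.P0 = s.P0 ∩ halfspace w p) (hT : s'.Tbar = s.Tbar ∪ {Tᵀ *ᵥ w}) :
    IsCutSet P c T (insert (w, p) F) s' where
  finite := h.finite.insert _
  P0_eq := by rw [h0, h.P0_eq, Set.biInter_insert, Set.inter_comm]
  Tbar_eq := by rw [hT, h.Tbar_eq, Set.image_insert_eq, Set.union_singleton]
  weight := by
    rintro p (rfl | hp)
    · exact hw
    · exact h.weight p hp

/-- The cut given by optimal solutions of `P₂(v, d)` and `D₂(v, d)`. -/
lemma IsCutSet.cut (h : IsCutSet P c T F s) (hP : P.Assumptions) (hc : c ∈ interior P.C)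
    (hR : cone (R : Set (Fin q → ℝ)) = P.C) (hv : HasSlaterPoint P R s)
    {d w : Fin q → ℝ} {x : Fin n → ℝ} {z : ℝ}
    (hx : P.IsOptP2 s.v d x z) (hw : P.IsOptD2 s.v d w)
    (h0 : s'.P0 = (s.cut P c T x w).P0) (hT : s'.Tbar = (s.cut P c T x w).Tbar) :
    ∃ F', IsCutSet P c T F' s' := by
  obtain ⟨x₀, hx₀, hv⟩ := hv
  rw [hv] at hx hw
  obtain ⟨β, hβ⟩ := hP.bddBelow_of_isOptD2 hc hR hx₀ hx hw
  have hw0 : w ≠ 0 := by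
    rintro rfl
    have := hw.1.1
    simp at this
  have hcw : 0 < c ⬝ᵥ w := dotProduct_comm c w ▸ dotProduct_pos_of_mem_interior hc hw.1.2 hw0
  have hinv := inv_pos.2 hcw
  refine ⟨_, h.insert (w := (c ⬝ᵥ w)⁻¹ • w) (p := P.Γ x) ⟨?_, fun k hk => ?_, (c ⬝ᵥ w)⁻¹ * β,
    fun x hx => ?_⟩ (h0.trans ?_) hT⟩
  · rw [dotProduct_smul, smul_eq_mul, inv_mul_cancel₀ hcw.ne']
  · rw [smul_dotProduct]
    exact mul_nonneg hinv.le (hw.1.2 k hk)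
  · rw [smul_dotProduct]
    exact mul_le_mul_of_nonneg_left (hβ x hx) hinv.le
  -- The algorithm cuts with `w` but records the normalized weight; both define the same halfspace.
  · rw [halfspace_smul hinv]
    rfl

lemma AlgStep.invariant (hP : P.Assumptions) (hc : c ∈ interior P.C)
    (hR : cone (R : Set (Fin q → ℝ)) = P.C)
    (hRstar : cone (Rstar : Set (Fin q → ℝ)) = posDual P.C)
    (hRstar1 : ∀ z ∈ Rstar, c ⬝ᵥ z = 1) {δ : ℝ} (hstep : AlgStep P c T R Rstar δ s s')
    (hinv : ∃ F, IsCutSet P c T F s ∧ PhaseInvariant P R Rstar F s) :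
    ∃ F, IsCutSet P c T F s' ∧ PhaseInvariant P R Rstar F s' := by
  obtain ⟨F, hF, hph⟩ := hinv
  cases hstep with
  | infeasible hs hX => exact ⟨F, hF.congr rfl rfl, trivial⟩
  | feasible hs x₀ hx₀ =>
    exact ⟨F, hF.congr rfl rfl, ⟨x₀, hx₀, rfl⟩, fun _ z hz => Or.inl hz, subset_rfl⟩
  | boundednessUnb todo hs z hz hu =>
    simp only [PhaseInvariant, hs] at hph
    -- The treated `z` yields no cut, but `b` is now false, so the claim that all treated weights
    -- are in `F` is vacuous.
    exact ⟨F, hF.congr rfl rfl, hph.1, fun h => absurd h Bool.false_ne_true,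
      Set.sdiff_subset.trans hph.2.2⟩
  | boundednessOpt todo hs z hz x hx =>
    simp only [PhaseInvariant, hs] at hph
    have hzR := hph.2.2 hz
    refine ⟨_, hF.insert (w := z) (p := P.Γ x)
      ⟨hRstar1 z hzR, hRstar ▸ subset_cone _ hzR, _, hx.2⟩ rfl rfl, hph.1, fun hb y hy => ?_,
      Set.sdiff_subset.trans hph.2.2⟩
    by_cases hyz : y = z
    · exact Or.inr ⟨_, Set.mem_insert _ _, hyz.symm⟩
    · exact (hph.2.1 hb y hy).imp (fun h => ⟨h, hyz⟩)
        fun h => Set.image_mono (Set.subset_insert _ _) h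
  | boundednessEnd hs =>
    simp only [PhaseInvariant, hs] at hph
    exact ⟨F, hF.congr rfl rfl, hph.1, fun hb z hz => (hph.2.1 hb z hz).resolve_left (by simp)⟩
  | stopBounded hs hb =>
    simp only [PhaseInvariant, hs] at hph
    exact ⟨F, hF.congr rfl rfl, Or.inr ⟨rfl, hph.2 hb⟩⟩
  | continueUnbounded hs hb =>
    simp only [PhaseInvariant, hs] at hph
    exact ⟨F, hF.congr rfl rfl, hph.1⟩
  | linealityUnb todo hs d hd hu =>
    simp only [PhaseInvariant, hs] at hph
    exact ⟨F, hF.congr rfl rfl, hph⟩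
  | linealityOpt todo hs d hd x z hx w hw =>
    simp only [PhaseInvariant, hs] at hph
    obtain ⟨F', hF'⟩ := hF.cut (s' := { s.cut P c T x w with phase := .lineality (todo \ {d}) })
      hP hc hR hph hx hw rfl rfl
    exact ⟨F', hF', hph⟩
  | linealityEnd hs =>
    simp only [PhaseInvariant, hs] at hph
    exact ⟨F, hF.congr rfl rfl, hph⟩
  | computeOuter hs =>
    simp only [PhaseInvariant, hs] at hph
    exact ⟨F, hF.congr rfl rfl, hph, rfl⟩
  | loopClose hs d hd r hr hmin hδ =>
    refine ⟨F, hF.congr rfl rfl, ?_⟩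
    simpa only [PhaseInvariant, hs, HasSlaterPoint] using hph
  | loopUnb hs d hd r hr hmin hδ lam hlam0 hlam1 e he he0 hu =>
    refine ⟨F, hF.congr rfl rfl, ?_⟩
    simpa only [PhaseInvariant, hs, HasSlaterPoint] using hph
  | loopOpt hs d hd r hr hmin hδ lam hlam0 hlam1 e he he0 x z hx w hw =>
    simp only [PhaseInvariant, hs] at hph
    obtain ⟨F', hF'⟩ := hF.cut
      (s' := { s.cut P c T x w with YOut := outerDirections (s.cut P c T x w).P0 })
      hP hc hR hph.1 hx hw rfl rfl
    refine ⟨F', hF', ?_⟩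
    simp only [PhaseInvariant, AlgState.cut, hs]
    exact ⟨hph.1, trivial⟩
  | loopEnd hs hempty =>
    simp only [PhaseInvariant, hs] at hph
    exact ⟨F, hF.congr rfl rfl, Or.inl hph.2⟩

/-- When the algorithm returns, the weights behind `Tbar` lie in `(cone YOut)⁺`, and their convex
hull contains the normalized part of it. -/
lemma AlgReturns.exists_isCutSet (hP : P.Assumptions) (hc : c ∈ interior P.C)
    (hR : cone (R : Set (Fin q → ℝ)) = P.C)
    (hRstar : cone (Rstar : Set (Fin q → ℝ)) = posDual P.C)
    (hRstar1 : ∀ z ∈ Rstar, c ⬝ᵥ z = 1) {δ : ℝ} (hs : AlgReturns P c T R Rstar δ s) :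
    ∃ F, IsCutSet P c T F s ∧ Prod.fst '' F ⊆ posDual (cone s.YOut) ∧
      ∀ y ∈ posDual (cone s.YOut), c ⬝ᵥ y = 1 → y ∈ convexHull ℝ (Prod.fst '' F) := by
  obtain ⟨F, hF, hph⟩ : ∃ F, IsCutSet P c T F s ∧ PhaseInvariant P R Rstar F s := by
    obtain ⟨hrun, -⟩ := hs
    induction hrun with
    | refl => exact ⟨∅, ⟨Set.finite_empty, by simp [initState], by simp [initState], by simp⟩,
        trivial⟩
    | tail _ hstep ih => exact hstep.invariant hP hc hR hRstar hRstar1 ih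
  have hWc : ∀ w ∈ Prod.fst '' F, c ⬝ᵥ w = 1 := by
    rintro _ ⟨p, hp, rfl⟩
    exact (hF.weight p hp).normalized
  simp only [PhaseInvariant, hs.2] at hph
  refine ⟨F, hF, ?_⟩
  suffices h : Prod.fst '' F ⊆ posDual (cone s.YOut) ∧
      posDual (cone s.YOut) ⊆ posDual {d | ∀ w ∈ Prod.fst '' F, 0 ≤ w ⬝ᵥ d} from
    ⟨h.1, fun y hy hyc =>
      mem_convexHull_of_mem_posDual (hF.finite.image _) hWc hyc (h.2 hy)⟩
  rcases hph with hY | ⟨hY, hall⟩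
  · have hrec : recCone s.P0 = {d | ∀ w ∈ Prod.fst '' F, 0 ≤ w ⬝ᵥ d} := by
      rw [hF.P0_eq]
      exact recCone_biInter_halfspace hF.finite fun p hp => (hF.weight p hp).normalized
    have hset : {d : Fin q → ℝ | ∀ w ∈ Prod.fst '' F, 0 ≤ w ⬝ᵥ d} =
        ⋂ w ∈ Prod.fst '' F, {d | 0 ≤ w ⬝ᵥ d} := by
      ext
      simp only [Set.mem_ofPred_eq, Set.mem_iInter]
    have heq : posDual (cone s.YOut) = posDual {d | ∀ w ∈ Prod.fst '' F, 0 ≤ w ⬝ᵥ d} := by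
      rw [posDual_cone, hY, outerDirections, hrec]
      refine posDual_extremePoints ?_ ?_ fun a ha d hd w hw => ?_
      · rw [hset]
        exact isClosed_biInter fun w _ =>
          isClosed_le continuous_const (continuous_dotProduct_right w)
      · rw [hset]
        exact convex_iInter₂ fun w _ => convex_halfSpace_ge (isLinearMap_dotProduct_right w) 0
      · rw [dotProduct_smul]
        exact mul_nonneg ha.le (hd w hw)
    rw [heq]
    exact ⟨fun w hw d hd => hd w hw, subset_rfl⟩
  -- Bounded exit: `cone YOut = C`, and every weight of `R*` was recorded. A vector nonnegative
  -- against `W` is thus nonnegative against `cone R* = C⁺`.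
  · rw [hY, hR]
    refine ⟨?_, fun y hy d hd => ?_⟩
    · rintro _ ⟨p, hp, rfl⟩
      exact (hF.weight p hp).mem_posDual
    · rw [← hRstar] at hy
      rw [dotProduct_comm]
      refine dotProduct_nonneg_of_mem_cone (fun z hz => ?_) hy
      rw [dotProduct_comm]
      exact hd z (hall z hz)

end Invariant

/-! ### The dual problem -/

section Dual

variable {m : ℕ} {P : Problem n (m + 1)} {T : Matrix (Fin (m + 1)) (Fin (m + 1)) ℝ}

/-- Since the last column of `T` pairs to `1` with `w`, the last entry of `Tᵀw` is already `1`: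
overwriting it changes nothing, and `T⁻¹` undoes `T`. -/
lemma dualWeight_transpose_mulVec (hT : IsUnit T.det) {w : Fin (m + 1) → ℝ}
    (hw : (fun i => T i (Fin.last m)) ⬝ᵥ w = 1) : dualWeight T (Tᵀ *ᵥ w) = w := by
  have : (Tᵀ *ᵥ w) (Fin.last m) = 1 := hw
  rw [dualWeight, ← this, Function.update_eq_self, Matrix.mulVec_transpose, Matrix.vecMul_vecMul,
    Matrix.mul_nonsing_inv _ hT, Matrix.vecMul_one]

/-- Feasible points with a finite dual objective are maximizers: the first components of the
dual objective determine the weight. -/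
lemma isDualMaximizer_of_bddBelow {Y : Set (Fin (m + 1) → ℝ)} {t : Fin (m + 1) → ℝ}
    (hX : P.X.Nonempty) (ht : t ∈ dualFeasible T Y)
    (hb : ∃ β : ℝ, ∀ x ∈ P.X, β ≤ dualWeight T t ⬝ᵥ P.Γ x) : IsDualMaximizer P T Y t := by
  refine ⟨ht, ⟨t, ht, rfl⟩, ?_⟩
  rintro k ⟨⟨hk0, hk⟩, hkne⟩ ⟨t', -, h⟩
  have hfst : ∀ i : Fin m, t' i.castSucc = t i.castSucc := fun i => by
    have := congrFun (congrArg Prod.fst h) i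
    simpa [dualObj, extendReal, hk0 i] using this
  have hw : dualWeight T t' = dualWeight T t := by
    unfold dualWeight
    congr 1
    ext i
    refine Fin.lastCases (by simp) (fun i => ?_) i
    simp [hfst i]
  have hsnd := congrArg Prod.snd h
  simp only [dualObj, extendReal, hw, Prod.snd_add] at hsnd
  obtain ⟨β, hβ⟩ := hb
  obtain ⟨x, hx⟩ := hX
  have hbot : (⨅ x ∈ P.X, ((dualWeight T t ⬝ᵥ P.Γ x : ℝ) : EReal)) ≠ ⊥ :=
    ((EReal.bot_lt_coe β).trans_le
      (le_iInf₂ fun x hx => EReal.coe_le_coe_iff.2 (hβ x hx))).ne'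
  have htop : (⨅ x ∈ P.X, ((dualWeight T t ⬝ᵥ P.Γ x : ℝ) : EReal)) ≠ ⊤ :=
    ((iInf₂_le x hx).trans_lt (EReal.coe_lt_top _)).ne
  -- Finiteness is what allows cancellation: `r = r + k` forces `k = 0` in `ℝ`, but not at `±∞`.
  lift (⨅ x ∈ P.X, ((dualWeight T t ⬝ᵥ P.Γ x : ℝ) : EReal)) to ℝ using ⟨htop, hbot⟩ with r
  have hklast : k (Fin.last m) = 0 := by
    have : r = r + k (Fin.last m) := by exact_mod_cast hsnd
    linarith
  refine hkne (funext fun i => ?_)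
  exact Fin.lastCases hklast (fun i => hk0 i) i

end Dual

end UnboundedCVOP

theorem mainTheorem5 {n m : ℕ} (P : UnboundedCVOP.Problem n (m + 1)) (hP : P.Assumptions)
    (c : Fin (m + 1) → ℝ) (hc : c ∈ interior P.C) (hc1 : UnboundedCVOP.l1Norm c = 1)
    (T : Matrix (Fin (m + 1)) (Fin (m + 1)) ℝ) (hT : IsUnit T.det)
    (hTc : ∀ i, T i (Fin.last m) = c i)
    (R : Finset (Fin (m + 1) → ℝ)) (hR : UnboundedCVOP.cone (R : Set (Fin (m + 1) → ℝ)) = P.C)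
    (hR1 : ∀ d ∈ R, UnboundedCVOP.l1Norm d = 1)
    (Rstar : Finset (Fin (m + 1) → ℝ))
    (hRstar : UnboundedCVOP.cone (Rstar : Set (Fin (m + 1) → ℝ)) = UnboundedCVOP.posDual P.C)
    (hRstar1 : ∀ z ∈ Rstar, c ⬝ᵥ z = 1)
    (δ : ℝ) (hδ : 0 < δ)
    (s : UnboundedCVOP.AlgState n (m + 1))
    (hs : UnboundedCVOP.AlgReturns P c T R Rstar δ s) :
    (fun y => Tᵀ *ᵥ y) ''
        {y | UnboundedCVOP.IsExtremeDirection
          (UnboundedCVOP.posDual (UnboundedCVOP.cone s.YOut)) y ∧ c ⬝ᵥ y = 1} ⊆ s.Tbar ∧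
      ∀ t ∈ s.Tbar, UnboundedCVOP.IsDualMaximizer P T s.YOut t := by
  obtain ⟨F, hF, hsub, hconv⟩ := hs.exists_isCutSet hP hc hR hRstar hRstar1
  have hcT : (fun i => T i (Fin.last m)) = c := funext hTc
  constructor
  · rintro _ ⟨y, ⟨hy, hyc⟩, rfl⟩
    obtain ⟨p, hp, rfl⟩ := hy.mem_of_mem_convexHull hsub
      (by rintro _ ⟨p, hp, rfl⟩; exact (hF.weight p hp).normalized) hyc (hconv y hy.1 hyc)
    rw [hF.Tbar_eq]
    exact ⟨p, hp, rfl⟩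
  · intro t ht
    rw [hF.Tbar_eq] at ht
    obtain ⟨p, hp, rfl⟩ := ht
    have hw : UnboundedCVOP.dualWeight T (Tᵀ *ᵥ p.1) = p.1 :=
      UnboundedCVOP.dualWeight_transpose_mulVec hT (by rw [hcT]; exact (hF.weight p hp).normalized)
    refine UnboundedCVOP.isDualMaximizer_of_bddBelow (hP.X_solid.mono interior_subset) ?_ ?_
    · change UnboundedCVOP.dualWeight T (Tᵀ *ᵥ p.1) ∈
        UnboundedCVOP.posDual (UnboundedCVOP.cone s.YOut)
      rw [hw]
      exact hsub ⟨p, hp, rfl⟩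
    · simpa only [hw] using (hF.weight p hp).bddBelow
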